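/- Let $\mathbb K$ be $\mathbb R$ or $\mathbb C$. For a Banach space $X$ over $\mathbb K$, a closed subspace $J\subseteq X$ and $C>0$, say that $J$ is an $M(1,C)$-ideal in $X$ if there is a bounded linear projection $Q$ on the dual $X^*$ with $\|Q\|\le 1$, with kernel $J^\perp=\{f\in X^*: f|_J=0\}$, and with $$\|Qf\|+C\,\|f-Qf\|\le\|f\|\qquad\text{for all } f\in X^*.$$ For Banach spaces $E,F$ over $\mathbb K$ and $n\ge 1$, let $\mathcal P(^nE,F)$ be the Banach space of continuous $n$-homogeneous polynomials $P\colon E\to F$ (that is, continuous maps of the form $P(x)=A(x,\dots,x)$ with $A\colon E^n\to F$ symmetric and $n$-linear), with the norm $\|P\|=\sup\{\|P(x)\|: \|x\|\le 1\}$, and let $\mathcal P_w(^nE,F)$ be its subspace of polynomials that are weakly continuous on bounded sets (that is, $P(x_\alpha)\to P(x)$ in norm whenever $(x_\alpha)$ is a bounded net in $E$ converging weakly to $x$). **Proposition.** Let $E,F$ be Banach spaces over $\mathbb K$ such that there exists a quotient mapping $\rho\colon E\to F$, that is, a continuous linear map that maps the open unit ball of $E$ onto the open unit ball of $F$. If,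 for some integer $n\ge 1$ and some $C>0$, $\mathcal P_w(^nE,F)$ is an $M(1,C)$-ideal in $\mathcal P(^nE,F)$, then $F$ (canonically embedded) is an $M(1,C)$-ideal in $F^{**}$. -/

import Mathlib

noncomputable section

section IdealStructures

variable {𝕜 X : Type*} [RCLike 𝕜] [NormedAddCommGroup X] [NormedSpace 𝕜 X]

/-- `Q` is a linear projection on `X*` with kernel the annihilator of `J` and norm at most one
(hence of norm one, unless `J = 0` and `Q = 0`). Such a `Q` makes a closed `J` an ideal in `X`. -/
structure IsIdealProjection (J : Submodule 𝕜 X)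
    (Q : StrongDual 𝕜 X →L[𝕜] StrongDual 𝕜 X) : Prop where
  idem : ∀ f, Q (Q f) = Q f
  ker_eq : ∀ f, Q f = 0 ↔ ∀ y ∈ J, f y = 0
  norm_le : ‖Q‖ ≤ 1

/-- The closed subspace `J` of `X` is an `M(1,C)`-ideal in `X`. -/
def IsMOneIdeal (𝕜 X : Type*) [RCLike 𝕜] [NormedAddCommGroup X] [NormedSpace 𝕜 X]
    (C : ℝ) (J : Submodule 𝕜 X) : Prop :=
  IsClosed (J : Set X) ∧ ∃ Q : StrongDual 𝕜 X →L[𝕜] StrongDual 𝕜 X,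
    IsIdealProjection J Q ∧ ∀ f : StrongDual 𝕜 X, ‖Q f‖ + C * ‖f - Q f‖ ≤ ‖f‖

end IdealStructures

/-- The canonical copy of `F` in its bidual. -/
def canonicalCopy (𝕜 F : Type*) [RCLike 𝕜] [NormedAddCommGroup F] [NormedSpace 𝕜 F] :
    Submodule 𝕜 (StrongDual 𝕜 (StrongDual 𝕜 F)) :=
  LinearMap.range (NormedSpace.inclusionInDoubleDual 𝕜 F : F →ₗ[𝕜] StrongDual 𝕜 (StrongDual 𝕜 F))

/-- Quotient mappings between normed spaces, in the isometric sense: `ρ` maps the open unit ball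
onto the open unit ball, so that `F` is isometric to `E / ker ρ`. -/
def IsMetricQuotientMap {𝕜 E F : Type*} [RCLike 𝕜] [NormedAddCommGroup E] [NormedSpace 𝕜 E]
    [NormedAddCommGroup F] [NormedSpace 𝕜 F] (ρ : E →L[𝕜] F) : Prop :=
  ρ '' Metric.ball 0 1 = Metric.ball 0 1

section Polynomials

variable (𝕜 : Type*) (n : ℕ) (E F : Type*) [RCLike 𝕜] [NormedAddCommGroup E] [NormedSpace 𝕜 E]
  [NormedAddCommGroup F] [NormedSpace 𝕜 F]

/-- The vector space of continuous `n`-homogeneous polynomials, as functions `E → F`. -/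
def contHomPolySubmodule : Submodule 𝕜 (E → F) where
  carrier := {P | Continuous P ∧ ∃ A : MultilinearMap 𝕜 (fun _ : Fin n => E) F,
    (∀ (σ : Equiv.Perm (Fin n)) (v : Fin n → E), A (fun i => v (σ i)) = A v) ∧
      ∀ x, P x = A (fun _ => x)}
  add_mem' := by
    rintro P Q ⟨hP, A, hA, hPA⟩ ⟨hQ, B, hB, hQB⟩
    refine ⟨hP.add hQ, A + B, fun σ v => ?_, fun x => ?_⟩
    · simp only [add_apply, hA, hB]
    · simp only [Pi.add_apply, add_apply, hPA, hQB]
  zero_mem' := ⟨continuous_zero, 0, fun _ _ => rfl, fun _ => rfl⟩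
  smul_mem' := by
    rintro c P ⟨hP, A, hA, hPA⟩
    refine ⟨hP.const_smul c, c • A, fun σ v => ?_, fun x => ?_⟩
    · simp only [smul_apply, hA]
    · simp only [Pi.smul_apply, smul_apply, hPA]

/-- The type of continuous `n`-homogeneous polynomials from `E` to `F`; it is normed below. -/
def ContHomPoly : Type _ := ↥(contHomPolySubmodule 𝕜 n E F)

namespace ContHomPoly

instance : AddCommGroup (ContHomPoly 𝕜 n E F) :=
  inferInstanceAs (AddCommGroup ↥(contHomPolySubmodule 𝕜 n E F))

instance : Module 𝕜 (ContHomPoly 𝕜 n E F) :=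
  inferInstanceAs (Module 𝕜 ↥(contHomPolySubmodule 𝕜 n E F))

variable {𝕜 n E F}

instance : CoeFun (ContHomPoly 𝕜 n E F) (fun _ => E → F) := ⟨fun P => P.1⟩

theorem ext' {P Q : ContHomPoly 𝕜 n E F} (h : ∀ x, P x = Q x) : P = Q :=
  Subtype.ext (funext h)

@[simp] theorem zero_apply (x : E) : (0 : ContHomPoly 𝕜 n E F) x = 0 := rfl

@[simp] theorem add_apply (P Q : ContHomPoly 𝕜 n E F) (x : E) : (P + Q) x = P x + Q x := rfl

@[simp] theorem neg_apply (P : ContHomPoly 𝕜 n E F) (x : E) : (-P) x = -P x := rfl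

@[simp] theorem smul_apply (c : 𝕜) (P : ContHomPoly 𝕜 n E F) (x : E) : (c • P) x = c • P x := rfl

theorem continuous (P : ContHomPoly 𝕜 n E F) : Continuous P := P.2.1

theorem map_smul (P : ContHomPoly 𝕜 n E F) (c : 𝕜) (x : E) : P (c • x) = c ^ n • P x := by
  obtain ⟨-, A, -, hA⟩ := P.2
  have h := A.map_smul_univ (fun _ => c) (fun _ => x)
  simp only [Finset.prod_const, Finset.card_univ, Fintype.card_fin] at h
  rw [hA, hA, h]

/-- The supremum of `‖P x‖` over the closed unit ball of `E`. -/
def supNorm (P : ContHomPoly 𝕜 n E F) : ℝ :=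
  sSup ((fun x => ‖P x‖) '' Metric.closedBall (0 : E) 1)

theorem bddAbove (P : ContHomPoly 𝕜 n E F) :
    BddAbove ((fun x => ‖P x‖) '' Metric.closedBall (0 : E) 1) := by
  obtain ⟨δ, hδ, h⟩ := Metric.continuousAt_iff.1 (P.continuous.continuousAt (x := (0 : E))) 1 one_pos
  have hc : (0 : ℝ) < δ / 2 := by positivity
  refine ⟨((δ / 2) ^ n)⁻¹ * (1 + ‖P 0‖), ?_⟩
  rintro _ ⟨x, hx, rfl⟩
  have hx1 : ‖x‖ ≤ 1 := by simpa using hx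
  have hn : ‖((δ / 2 : ℝ) : 𝕜)‖ = δ / 2 := by rw [RCLike.norm_ofReal, abs_of_pos hc]
  have h1 : ‖P (((δ / 2 : ℝ) : 𝕜) • x)‖ ≤ 1 + ‖P 0‖ := by
    have h2 : dist (((δ / 2 : ℝ) : 𝕜) • x) 0 < δ := by
      rw [dist_zero_right, norm_smul, hn]
      nlinarith
    have h3 := (h h2).le
    rw [dist_eq_norm] at h3
    have h4 := norm_le_norm_add_norm_sub' (P (((δ / 2 : ℝ) : 𝕜) • x)) (P 0)
    linarith
  rw [map_smul, norm_smul, norm_pow, hn] at h1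
  change ‖P x‖ ≤ _
  rw [inv_mul_eq_div, le_div_iff₀ (by positivity)]
  linarith

theorem le_supNorm (P : ContHomPoly 𝕜 n E F) {x : E} (hx : ‖x‖ ≤ 1) : ‖P x‖ ≤ P.supNorm :=
  le_csSup P.bddAbove ⟨x, by simpa using hx, rfl⟩

theorem supNorm_le (P : ContHomPoly 𝕜 n E F) {M : ℝ} (h : ∀ x, ‖x‖ ≤ 1 → ‖P x‖ ≤ M) :
    P.supNorm ≤ M := by
  refine csSup_le ⟨_, 0, by simp, rfl⟩ ?_
  rintro _ ⟨x, hx, rfl⟩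
  exact h x (by simpa using hx)

theorem eq_zero_of_supNorm (P : ContHomPoly 𝕜 n E F) (h : P.supNorm = 0) : P = 0 := by
  refine ext' fun x => ?_
  have hr : (0 : ℝ) < ‖x‖ + 1 := by positivity
  have hn : ‖((‖x‖ + 1 : ℝ) : 𝕜)‖ = ‖x‖ + 1 := by rw [RCLike.norm_ofReal, abs_of_pos hr]
  have hc : ((‖x‖ + 1 : ℝ) : 𝕜) ≠ 0 := by
    rw [← norm_pos_iff, hn]
    exact hr
  have h1 : ‖((‖x‖ + 1 : ℝ) : 𝕜)⁻¹ • x‖ ≤ 1 := by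
    rw [norm_smul, norm_inv, hn, inv_mul_eq_div, div_le_one hr]
    linarith
  have h2 : P (((‖x‖ + 1 : ℝ) : 𝕜)⁻¹ • x) = 0 := by
    rw [← norm_le_zero_iff, ← h]
    exact P.le_supNorm h1
  rw [map_smul, smul_eq_zero] at h2
  rcases h2 with h2 | h2
  · exact absurd h2 (pow_ne_zero _ (inv_ne_zero hc))
  · exact h2

/-- The Banach space norm `‖P‖ = sup {‖P x‖ : ‖x‖ ≤ 1}`. -/
instance : NormedAddCommGroup (ContHomPoly 𝕜 n E F) :=
  AddGroupNorm.toNormedAddCommGroup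
    { toFun := supNorm
      map_zero' := le_antisymm (supNorm_le _ fun x _ => by simp)
        ((norm_nonneg _).trans (le_supNorm (0 : ContHomPoly 𝕜 n E F) (x := (0 : E)) (by simp)))
      add_le' := fun P Q => supNorm_le _ fun x hx =>
        (norm_add_le _ _).trans (add_le_add (P.le_supNorm hx) (Q.le_supNorm hx))
      neg' := fun P => by simp only [supNorm, neg_apply, norm_neg]
      eq_zero_of_map_eq_zero' := fun P h => P.eq_zero_of_supNorm h }

theorem norm_def (P : ContHomPoly 𝕜 n E F) :
    ‖P‖ = sSup ((fun x => ‖P x‖) '' Metric.closedBall (0 : E) 1) := rfl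

instance : NormedSpace 𝕜 (ContHomPoly 𝕜 n E F) where
  toModule := inferInstanceAs (Module 𝕜 (ContHomPoly 𝕜 n E F))
  norm_smul_le c P := supNorm_le _ fun x hx => by
    rw [smul_apply, norm_smul]
    exact mul_le_mul_of_nonneg_left (P.le_supNorm hx) (norm_nonneg c)

end ContHomPoly

/-- The subspace of those continuous `n`-homogeneous polynomials that are weakly continuous on
bounded sets: for each norm-bounded `B`, the restriction of `P` to `B` is continuous from the
weak topology to the norm topology; in other words, `P x_α → P x` in norm for every bounded net
`x_α` that converges weakly to `x`. -/
def weaklyContPoly : Submodule 𝕜 (ContHomPoly 𝕜 n E F) where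
  carrier := {P | ∀ B : Set E, Bornology.IsBounded B →
    ContinuousOn (fun y : WeakSpace 𝕜 E => P ((toWeakSpace 𝕜 E).symm y))
      ((toWeakSpace 𝕜 E).symm ⁻¹' B)}
  add_mem' := fun hP hQ B hB => (hP B hB).add (hQ B hB)
  zero_mem' := fun _ _ => continuousOn_const
  smul_mem' := fun c _ hP B hB => (hP B hB).const_smul c

end Polynomials

end

/-!
Let `η ∈ F**` have norm one. Since `ρ` is a quotient mapping, `φ ↦ φ ∘ ρ` embeds `F*` isometrically
into `E*`, so by Hahn–Banach `η` lifts to some `ξ ∈ E**` of norm one, and by Goldstine `ξ` is the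
weak* limit of an ultrafilter on the closed unit ball of `E`. The weak* limit of `P x` along it is
an operator `Λ : 𝒫(ⁿE, F) → F**` of norm at most one, and it satisfies
`Λ (ψ ^ (n - 1) ρ) = ξ(ψ) ^ (n - 1) η` and `Λ (ψ ^ n y) = ξ(ψ) ^ n y`. It maps `𝒫_w(ⁿE, F)` into
`F`, since there `P x` converges in norm: along the ultrafilter, differences of points tend weakly
to `0`, where `P` is weakly continuous, and the finite differences of `P` are weakly continuous of
lower degree.

For `f ∈ F***` let `g` be its Dixmier projection, so that `f` and `g` agree on `F` and
`‖g‖ = ‖g|_F‖`. The restriction of `g ∘ Λ` to `𝒫_w(ⁿE, F)` has the same norm as `g ∘ Λ`, so the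
`M(1,C)` inequality forces `Q (g ∘ Λ) = g ∘ Λ`. Hence `Q (f ∘ Λ) = g ∘ Λ`, and the inequality for
`f ∘ Λ` gives `‖g‖ + C |(f - g) η| ≤ ‖f‖`.
-/

open Filter Topology Metric NormedSpace Bornology
open scoped Pointwise fwdDiff

section PolynomialMaps

variable (G H : Type*) [AddCommGroup G] [AddCommGroup H]

/-- Maps between abelian groups that are polynomial of degree `< n` in the sense of Fréchet: all
their `n`-fold differences vanish. -/
def polynomialMapsDegreeLT : ℕ → Submodule ℤ (G → H)
  | 0 => ⊥
  | n + 1 => ⨅ h, (polynomialMapsDegreeLT n).comap (fwdDiff_aux.fwdDiffₗ G H h)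

variable {G H}

theorem mem_polynomialMapsDegreeLT_zero {f : G → H} : f ∈ polynomialMapsDegreeLT G H 0 ↔ f = 0 :=
  Submodule.mem_bot ℤ

theorem mem_polynomialMapsDegreeLT_succ {n : ℕ} {f : G → H} :
    f ∈ polynomialMapsDegreeLT G H (n + 1) ↔ ∀ h, Δ_[h] f ∈ polynomialMapsDegreeLT G H n := by
  simp only [polynomialMapsDegreeLT, Submodule.mem_iInf, Submodule.mem_comap,
    fwdDiff_aux.coe_fwdDiffₗ]

theorem polynomialMapsDegreeLT_mono : Monotone (polynomialMapsDegreeLT G H) := by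
  refine monotone_nat_of_le_succ fun n => ?_
  induction n with
  | zero => exact bot_le
  | succ n ih => exact iInf_mono fun h => Submodule.comap_mono ih

theorem fwdDiff_multilinear_diag {R M N : Type*} [Semiring R] [AddCommGroup M] [Module R M]
    [AddCommGroup N] [Module R N] {n : ℕ} (A : MultilinearMap R (fun _ : Fin n => M) N) (h : M) :
    (Δ_[h] fun x => A fun _ => x) =
      ∑ s ∈ Finset.univ.erase (Finset.univ : Finset (Fin n)),
        fun x => A.restr s rfl h fun _ => x := by
  classical
  ext x
  have hexpand : (A fun _ => x + h) = ∑ s : Finset (Fin n), A.restr s rfl h fun _ => x := by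
    refine (A.map_add_univ (fun _ => x) fun _ => h).trans (Finset.sum_congr rfl fun s _ => ?_)
    refine congrArg A (funext fun i => ?_)
    by_cases hi : i ∈ s <;> simp [hi]
  have huniv : (A.restr Finset.univ rfl h fun _ => x) = A fun _ => x :=
    congrArg A (funext fun i => by simp)
  rw [fwdDiff, hexpand, ← Finset.add_sum_erase _ _ (Finset.mem_univ Finset.univ), huniv,
    add_sub_cancel_left, Finset.sum_apply]

theorem multilinear_diag_mem_polynomialMapsDegreeLT {R M N : Type*} [Semiring R] [AddCommGroup M]
    [Module R M] [AddCommGroup N] [Module R N] {n : ℕ}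
    (A : MultilinearMap R (fun _ : Fin n => M) N) :
    (fun x => A fun _ => x) ∈ polynomialMapsDegreeLT M N (n + 1) := by
  induction n using Nat.strong_induction_on with
  | _ n ih =>
    refine mem_polynomialMapsDegreeLT_succ.2 fun h => ?_
    rw [fwdDiff_multilinear_diag]
    refine Submodule.sum_mem _ fun s hs => ?_
    have hcard : s.card < n := by
      simpa using (Finset.card_lt_iff_ne_univ s).2 (Finset.ne_of_mem_erase hs)
    exact polynomialMapsDegreeLT_mono hcard (ih _ hcard _)

end PolynomialMaps

theorem cauchy_map_of_forall_exists_dist_lt {α β : Type*} [PseudoMetricSpace β] {l : Filter α}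
    [l.NeBot] {f : α → β}
    (h : ∀ ε > 0, ∃ g : α → β, Cauchy (map g l) ∧ ∀ᶠ x in l, dist (f x) (g x) < ε) :
    Cauchy (map f l) := by
  refine cauchy_map_iff'.2 (uniformity_basis_dist.tendsto_right_iff.2 fun ε hε => ?_)
  obtain ⟨g, hg, hfg⟩ := h (ε / 3) (by positivity)
  have hgε := uniformity_basis_dist.tendsto_right_iff.1 (cauchy_map_iff'.1 hg) (ε / 3)
    (by positivity)
  filter_upwards [hgε, hfg.prod_mk hfg] with p hp ⟨h₁, h₂⟩
  rw [dist_comm] at h₂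
  have htri := dist_triangle4 (f p.1) (g p.1) (g p.2) (f p.2)
  change dist (g p.1) (g p.2) < ε / 3 at hp
  change dist (f p.1) (f p.2) < ε
  linarith

section Bidual

variable {𝕜 E F : Type*} [RCLike 𝕜] [NormedAddCommGroup E] [NormedSpace 𝕜 E]
  [NormedAddCommGroup F] [NormedSpace 𝕜 F]

theorem norm_mem_closure_image_closedBall (f : StrongDual 𝕜 E) :
    (‖f‖ : 𝕜) ∈ closure (f '' closedBall 0 1) := by
  refine Metric.mem_closure_iff.2 fun ε hε => ?_
  obtain ⟨x, hx, hfx⟩ := f.exists_lt_apply_of_lt_opNorm (sub_lt_self ‖f‖ hε)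
  obtain ⟨c, hc, hcx⟩ := RCLike.exists_norm_eq_mul_self (f x)
  refine ⟨f (c • x), ⟨c • x, by simpa [norm_smul, hc] using hx.le, rfl⟩, ?_⟩
  rw [map_smul, smul_eq_mul, ← hcx, dist_eq_norm, ← RCLike.ofReal_sub, RCLike.norm_ofReal,
    abs_sub_lt_iff]
  constructor <;> linarith [f.unit_le_opNorm x hx.le]

theorem mul_norm_le_of_forall_re_le {f : StrongDual 𝕜 E} {r u : ℝ} (hr : 0 ≤ r)
    (h : ∀ x ∈ closedBall (0 : E) r, RCLike.re (f x) ≤ u) : r * ‖f‖ ≤ u := by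
  have hclosed : IsClosed {z : 𝕜 | r * RCLike.re z ≤ u} :=
    isClosed_le (by fun_prop) continuous_const
  have himage : f '' closedBall 0 1 ⊆ {z : 𝕜 | r * RCLike.re z ≤ u} := by
    rintro _ ⟨x, hx, rfl⟩
    have hrx : (r : 𝕜) • x ∈ closedBall (0 : E) r := by
      rw [mem_closedBall_zero_iff] at hx ⊢
      rw [norm_smul, RCLike.norm_of_nonneg hr]
      exact mul_le_of_le_one_right hr hx
    simpa using h _ hrx
  simpa using closure_minimal himage hclosed (norm_mem_closure_image_closedBall f)

theorem exists_re_lt_of_notMem_closure_weakBilin {V W : Type*} [AddCommGroup V] [Module 𝕜 V]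
    [Module ℝ V] [IsScalarTower ℝ 𝕜 V] [AddCommGroup W] [Module 𝕜 W] {B : V →ₗ[𝕜] W →ₗ[𝕜] 𝕜}
    {s : Set (WeakBilin B)} (hs : Convex ℝ s) {v : WeakBilin B} (hv : v ∉ closure s) :
    ∃ (w : W) (u : ℝ), (∀ a ∈ s, RCLike.re (B a w) < u) ∧ u < RCLike.re (B v w) := by
  have : ContinuousSMul ℝ (WeakBilin B) := IsScalarTower.continuousSMul 𝕜
  obtain ⟨f, u, hf, hu⟩ :=
    RCLike.geometric_hahn_banach_closed_point (𝕜 := 𝕜) hs.closure isClosed_closure hv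
  obtain ⟨w, rfl⟩ := B.dualEmbedding_surjective f
  exact ⟨w, u, fun a ha => hf a (subset_closure ha), hu⟩

theorem exists_re_lt_of_notMem_closure_weakDual {s : Set (WeakDual 𝕜 E)} (hs : Convex ℝ s)
    {ξ : WeakDual 𝕜 E} (hξ : ξ ∉ closure s) :
    ∃ (x : E) (u : ℝ), (∀ ζ ∈ s, RCLike.re (ζ x) < u) ∧ u < RCLike.re (ξ x) :=
  exists_re_lt_of_notMem_closure_weakBilin (B := topDualPairing 𝕜 E) hs hξ

theorem convex_image_inclusionInDoubleDual_closedBall (r : ℝ) :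
    Convex ℝ ((fun x : E => StrongDual.toWeakDual (inclusionInDoubleDual 𝕜 E x)) ''
      closedBall 0 r) := by
  rintro _ ⟨x, hx, rfl⟩ _ ⟨y, hy, rfl⟩ a b ha hb hab
  refine ⟨(a : 𝕜) • x + (b : 𝕜) • y, ?_, ?_⟩
  · rw [mem_closedBall_zero_iff] at hx hy ⊢
    calc ‖(a : 𝕜) • x + (b : 𝕜) • y‖ ≤ a * ‖x‖ + b * ‖y‖ := by
          simpa only [norm_smul, RCLike.norm_of_nonneg ha, RCLike.norm_of_nonneg hb] using
            norm_add_le ((a : 𝕜) • x) ((b : 𝕜) • y)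
      _ ≤ a * r + b * r := by gcongr
      _ = r := by rw [← add_mul, hab, one_mul]
  · refine ContinuousLinearMap.ext fun φ => ?_
    change φ ((a : 𝕜) • x + (b : 𝕜) • y) = a • φ x + b • φ y
    simp only [map_add, map_smul, RCLike.real_smul_eq_coe_mul, smul_eq_mul]

theorem goldstine (ξ : StrongDual 𝕜 (StrongDual 𝕜 E)) :
    StrongDual.toWeakDual ξ ∈ closure
      ((fun x => StrongDual.toWeakDual (inclusionInDoubleDual 𝕜 E x)) '' closedBall 0 ‖ξ‖) := by
  by_contra hξ
  obtain ⟨φ, u, hφ, hu⟩ := exists_re_lt_of_notMem_closure_weakDual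
    (convex_image_inclusionInDoubleDual_closedBall ‖ξ‖) hξ
  have hnorm : ‖ξ‖ * ‖φ‖ ≤ u := mul_norm_le_of_forall_re_le (norm_nonneg ξ) fun x hx =>
    (hφ _ ⟨x, hx, rfl⟩).le
  exact hu.not_ge ((RCLike.re_le_norm _).trans ((ξ.le_opNorm φ).trans hnorm))

theorem exists_ultrafilter_tendsto_bidual (ξ : StrongDual 𝕜 (StrongDual 𝕜 E)) :
    ∃ U : Ultrafilter E, closedBall 0 ‖ξ‖ ∈ U ∧
      ∀ φ : StrongDual 𝕜 E, Tendsto φ U (𝓝 (ξ φ)) := by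
  have hξ : MapClusterPt (StrongDual.toWeakDual ξ) (𝓟 (closedBall (0 : E) ‖ξ‖)) fun x =>
      StrongDual.toWeakDual (inclusionInDoubleDual 𝕜 E x) := by
    rw [MapClusterPt, map_principal]
    exact mem_closure_iff_clusterPt.1 (goldstine ξ)
  obtain ⟨U, hU, hUξ⟩ := mapClusterPt_iff_ultrafilter.1 hξ
  exact ⟨U, le_principal_iff.1 hU, fun φ =>
    ((WeakDual.eval_continuous φ).tendsto (StrongDual.toWeakDual ξ)).comp hUξ⟩

end Bidual

section WeakContinuity

variable {𝕜 E F : Type*} [RCLike 𝕜] [NormedAddCommGroup E] [NormedSpace 𝕜 E]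
  [NormedAddCommGroup F]

variable (𝕜) in
/-- Weak continuity on bounded sets, phrased with filters: `f` maps bounded filters converging
weakly to `x` to filters converging in norm to `f x`. -/
def IsWeaklyContOnBounded (f : E → F) : Prop :=
  ∀ ⦃l : Filter E⦄ ⦃x : E⦄, (∃ s ∈ l, IsBounded s) →
    (∀ φ : StrongDual 𝕜 E, Tendsto φ l (𝓝 (φ x))) → Tendsto f l (𝓝 (f x))

namespace IsWeaklyContOnBounded

theorem fwdDiff {f : E → F} (hf : IsWeaklyContOnBounded 𝕜 f) (h : E) :
    IsWeaklyContOnBounded 𝕜 (Δ_[h] f) := by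
  rintro l x ⟨s, hsl, hs⟩ hlx
  have hshift : Tendsto f (l.map (· + h)) (𝓝 (f (x + h))) := by
    refine hf ⟨_, image_mem_map hsl,
      (IsometryEquiv.addRight h).isometry.lipschitz.isBounded_image hs⟩
      fun φ => tendsto_map'_iff.2 ?_
    simpa only [Function.comp_def, map_add] using (hlx φ).add_const (φ h)
  exact (tendsto_map'_iff.1 hshift).sub (hf ⟨s, hsl, hs⟩ hlx)

theorem tendsto_sub {f : E → F} (hf : IsWeaklyContOnBounded 𝕜 f) {l : Filter E}
    (hbdd : ∃ s ∈ l, IsBounded s) (hl : ∀ φ : StrongDual 𝕜 E, Cauchy (map φ l)) :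
    Tendsto (fun p : E × E => f (p.1 - p.2)) (l ×ˢ l) (𝓝 (f 0)) := by
  obtain ⟨s, hsl, hs⟩ := hbdd
  refine tendsto_map'_iff.1 (hf (l := (l ×ˢ l).map fun p => p.1 - p.2) ⟨s - s, ?_, hs.sub hs⟩
    fun φ => tendsto_map'_iff.2 ?_)
  · exact mem_map.2 (mem_of_superset (prod_mem_prod hsl hsl) fun p hp =>
      Set.sub_mem_sub hp.1 hp.2)
  · simpa only [Function.comp_def, map_zero, map_sub] using
      ((IsUniformAddGroup.cauchy_map_iff_tendsto l φ).1 (hl φ)).2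

theorem cauchy_map {n : ℕ} {f : E → F} (hf : IsWeaklyContOnBounded 𝕜 f)
    (hn : f ∈ polynomialMapsDegreeLT E F n) {l : Filter E} [l.NeBot]
    (hbdd : ∃ s ∈ l, IsBounded s) (hl : ∀ φ : StrongDual 𝕜 E, Cauchy (map φ l)) :
    Cauchy (map f l) := by
  induction n generalizing f l with
  | zero =>
    obtain rfl := mem_polynomialMapsDegreeLT_zero.1 hn
    exact (tendsto_const_nhds (x := (0 : F))).cauchy_map
  | succ n ih =>
    -- `f x = Δ_[x₀] f (x - x₀) + f (x - x₀)`, where the first term has lower degree and the second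
    -- is close to `f 0` for a suitable point `x₀` of the filter.
    refine cauchy_map_of_forall_exists_dist_lt fun ε hε => ?_
    have hnear : ∀ᶠ x₀ in l, ∀ᶠ x in l, dist (f (x - x₀)) (f 0) < ε := by
      refine Eventually.curry (p := fun p : E × E => dist (f (p.2 - p.1)) (f 0) < ε) ?_
      exact (hf.tendsto_sub hbdd hl).comp tendsto_prod_swap (ball_mem_nhds _ hε)
    obtain ⟨x₀, hx₀⟩ := hnear.exists
    have hdiff : Cauchy (map (Δ_[x₀] f) (l.map (· - x₀))) := by
      obtain ⟨s, hsl, hs⟩ := hbdd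
      refine ih (hf.fwdDiff x₀) (mem_polynomialMapsDegreeLT_succ.1 hn x₀)
        ⟨_, image_mem_map hsl,
          (IsometryEquiv.subRight x₀).isometry.lipschitz.isBounded_image hs⟩ fun φ => ?_
      simpa only [map_map, Function.comp_def, map_sub, id] using
        (hl φ).map (uniformContinuous_id.sub (uniformContinuous_const (b := φ x₀)))
    refine ⟨fun x => Δ_[x₀] f (x - x₀) + f 0, ?_, hx₀.mono fun x hx => ?_⟩
    · exact hdiff.map (uniformContinuous_id.add uniformContinuous_const)
    · have hsub : f x - (Δ_[x₀] f (x - x₀) + f 0) = f (x - x₀) - f 0 := by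
        simp only [_root_.fwdDiff, sub_add_cancel]
        abel
      rwa [dist_eq_norm, hsub, ← dist_eq_norm]

end IsWeaklyContOnBounded

end WeakContinuity

theorem exists_continuousLinearMap₂_tendsto {α 𝕜 X Y Z : Type*} [NontriviallyNormedField 𝕜]
    [SeminormedAddCommGroup X] [NormedSpace 𝕜 X] [SeminormedAddCommGroup Y] [NormedSpace 𝕜 Y]
    [NormedAddCommGroup Z] [NormedSpace 𝕜 Z] [ProperSpace Z] {U : Ultrafilter α}
    {T : α → X →L[𝕜] Y →L[𝕜] Z} {M : ℝ} (hM : 0 ≤ M) (hT : ∀ᶠ a in U, ‖T a‖ ≤ M) :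
    ∃ Λ : X →L[𝕜] Y →L[𝕜] Z, ‖Λ‖ ≤ M ∧ ∀ x y, Tendsto (fun a => T a x y) U (𝓝 (Λ x y)) := by
  have hlim (x : X) (y : Y) :
      ∃ z, ‖z‖ ≤ M * ‖x‖ * ‖y‖ ∧ Tendsto (fun a => T a x y) U (𝓝 z) := by
    have hball : closedBall 0 (M * ‖x‖ * ‖y‖) ∈ U.map fun a => T a x y :=
      hT.mono fun a ha => mem_closedBall_zero_iff.2 (((T a).le_opNorm₂ x y).trans (by gcongr))
    obtain ⟨z, hz, hlim⟩ :=
      (isCompact_closedBall 0 _).ultrafilter_le_nhds _ (le_principal_iff.2 hball)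
    exact ⟨z, mem_closedBall_zero_iff.1 hz, hlim⟩
  choose Λ hΛ hlim using hlim
  refine ⟨LinearMap.mkContinuous₂ (LinearMap.mk₂ 𝕜 Λ ?_ ?_ ?_ ?_) M hΛ,
    LinearMap.mkContinuous₂_norm_le _ hM _, hlim⟩
  · exact fun x x' y => tendsto_nhds_unique (hlim _ y) <| by
      simpa only [map_add, add_apply] using (hlim x y).add (hlim x' y)
  · exact fun c x y => tendsto_nhds_unique (hlim _ y) <| by
      simpa only [map_smul, smul_apply] using (hlim x y).const_smul c
  · exact fun x y y' => tendsto_nhds_unique (hlim x _) <| by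
      simpa only [map_add] using (hlim x y).add (hlim x y')
  · exact fun c x y => tendsto_nhds_unique (hlim x _) <| by
      simpa only [map_smul] using (hlim x y).const_smul c

namespace ContHomPoly

variable {𝕜 E F : Type*} {n : ℕ} [RCLike 𝕜] [NormedAddCommGroup E] [NormedSpace 𝕜 E]
  [NormedAddCommGroup F] [NormedSpace 𝕜 F]

theorem isWeaklyContOnBounded_of_mem_weaklyContPoly {P : ContHomPoly 𝕜 n E F}
    (hP : P ∈ weaklyContPoly 𝕜 n E F) : IsWeaklyContOnBounded 𝕜 P := by
  rintro l x ⟨s, hsl, hs⟩ hlx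
  have hweak : Tendsto (toWeakSpace 𝕜 E) l (𝓝 (toWeakSpace 𝕜 E x)) := by
    refine (WeakBilin.tendsto_iff_forall_eval_tendsto (topDualPairing 𝕜 E).flip ?_).2 hlx
    exact fun y z hyz => (inclusionInDoubleDualLi (E := E) 𝕜).injective
      (ContinuousLinearMap.ext fun φ => DFunLike.congr_fun hyz φ)
  exact (hP (insert x s) (hs.insert x) (toWeakSpace 𝕜 E x) (Set.mem_insert x s)).tendsto.comp
    (tendsto_nhdsWithin_iff.2 ⟨hweak, mem_of_superset hsl (Set.subset_insert x s)⟩)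

theorem cauchy_map_of_mem_weaklyContPoly {P : ContHomPoly 𝕜 n E F}
    (hP : P ∈ weaklyContPoly 𝕜 n E F) {l : Filter E} [l.NeBot] (hbdd : ∃ s ∈ l, IsBounded s)
    (hl : ∀ φ : StrongDual 𝕜 E, Cauchy (map φ l)) : Cauchy (map P l) := by
  obtain ⟨-, A, -, hA⟩ := P.2
  have hdegree : P.1 ∈ polynomialMapsDegreeLT E F (n + 1) := by
    rw [funext hA]
    exact multilinear_diag_mem_polynomialMapsDegreeLT A
  exact (isWeaklyContOnBounded_of_mem_weaklyContPoly hP).cauchy_map hdegree hbdd hl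

theorem norm_apply_le (P : ContHomPoly 𝕜 n E F) (x : E) : ‖P x‖ ≤ ‖P‖ * ‖x‖ ^ n := by
  have hx : (‖x‖ : 𝕜) • (‖x‖ : 𝕜)⁻¹ • x = x := by
    rcases eq_or_ne x 0 with rfl | hx
    · simp
    · rw [smul_inv_smul₀ (by simpa using hx)]
  have hunit : ‖(‖x‖ : 𝕜)⁻¹ • x‖ ≤ 1 := by
    rw [norm_smul, norm_inv, RCLike.norm_ofReal, abs_norm]
    exact inv_mul_le_one
  calc ‖P x‖ = ‖x‖ ^ n * ‖P ((‖x‖ : 𝕜)⁻¹ • x)‖ := by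
        conv_lhs => rw [← hx, map_smul, norm_smul, norm_pow, RCLike.norm_ofReal, abs_norm]
    _ ≤ ‖x‖ ^ n * ‖P‖ := by gcongr; exact P.le_supNorm hunit
    _ = ‖P‖ * ‖x‖ ^ n := mul_comm _ _

/-- Evaluation of `n`-homogeneous polynomials at a point, as a continuous linear map. -/
noncomputable def evalCLM (x : E) : ContHomPoly 𝕜 n E F →L[𝕜] F :=
  LinearMap.mkContinuous
    { toFun := fun P => P x
      map_add' := fun P Q => add_apply P Q x
      map_smul' := fun c P => smul_apply c P x } (‖x‖ ^ n) fun P => by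
    rw [mul_comm]
    exact P.norm_apply_le x

@[simp]
theorem evalCLM_apply (x : E) (P : ContHomPoly 𝕜 n E F) : evalCLM x P = P x := rfl

theorem norm_evalCLM_le (x : E) : ‖(evalCLM x : ContHomPoly 𝕜 n E F →L[𝕜] F)‖ ≤ ‖x‖ ^ n :=
  LinearMap.mkContinuous_norm_le _ (by positivity) _

/-- The homogeneous polynomial obtained by restricting a multilinear map to the diagonal; the
multilinear map is symmetrized, since the definition of `ContHomPoly` asks for a symmetric one. -/
noncomputable def ofDiag (A : MultilinearMap 𝕜 (fun _ : Fin n => E) F)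
    (hA : Continuous fun x => A fun _ => x) : ContHomPoly 𝕜 n E F :=
  ⟨fun x => A fun _ => x, hA,
    (Nat.factorial n : 𝕜)⁻¹ • ∑ σ : Equiv.Perm (Fin n), A.domDomCongr σ, by
    intro τ v
    simp only [_root_.smul_apply, sum_apply, MultilinearMap.domDomCongr_apply]
    congr 1
    exact Fintype.sum_equiv (Equiv.mulLeft τ) _ _ fun _ => rfl, by
    intro x
    have hfactorial : (Nat.factorial n : 𝕜) ≠ 0 := by exact_mod_cast n.factorial_ne_zero
    simp only [_root_.smul_apply, sum_apply, MultilinearMap.domDomCongr_apply, Finset.sum_const,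
      Finset.card_univ, Fintype.card_perm, Fintype.card_fin]
    rw [← Nat.cast_smul_eq_nsmul 𝕜, smul_smul, inv_mul_cancel₀ hfactorial, one_smul]⟩

/-- The homogeneous polynomial `x ↦ ψ(x) ^ m T(x)`. -/
noncomputable def powSMul (m : ℕ) (ψ : StrongDual 𝕜 E) (T : E →L[𝕜] F) :
    ContHomPoly 𝕜 (m + 1) E F :=
  ofDiag (LinearMap.uncurryLeft
    { toFun := fun x => ((MultilinearMap.mkPiAlgebra 𝕜 (Fin m) 𝕜).compLinearMap
        fun _ => (ψ : E →ₗ[𝕜] 𝕜)).smulRight (T x)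
      map_add' := fun x y => by ext; simp
      map_smul' := fun c x => by ext; simp [smul_smul, mul_comm] } :
    MultilinearMap 𝕜 (fun _ : Fin (m + 1) => E) F) (by
    have hcont : Continuous fun x => ψ x ^ m • T x := by fun_prop
    simpa [Fin.tail_def] using hcont)

@[simp]
theorem powSMul_apply (m : ℕ) (ψ : StrongDual 𝕜 E) (T : E →L[𝕜] F) (x : E) :
    powSMul m ψ T x = ψ x ^ m • T x := by
  change (LinearMap.uncurryLeft _ : MultilinearMap 𝕜 (fun _ : Fin (m + 1) => E) F) _ = _
  simp [Fin.tail_def]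

theorem norm_powSMul_le (m : ℕ) (ψ : StrongDual 𝕜 E) (T : E →L[𝕜] F) :
    ‖powSMul m ψ T‖ ≤ ‖ψ‖ ^ m * ‖T‖ := by
  refine supNorm_le _ fun x hx => ?_
  rw [powSMul_apply, norm_smul, norm_pow]
  gcongr
  · exact ψ.unit_le_opNorm x hx
  · exact T.unit_le_opNorm x hx

theorem powSMul_smulRight_mem (m : ℕ) (ψ : StrongDual 𝕜 E) (y : F) :
    powSMul m ψ (ψ.smulRight y) ∈ weaklyContPoly 𝕜 (m + 1) E F := by
  intro B _
  have hψ : Continuous fun z : WeakSpace 𝕜 E => ψ ((toWeakSpace 𝕜 E).symm z) :=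
    WeakBilin.eval_continuous (topDualPairing 𝕜 E).flip ψ
  refine Continuous.continuousOn ?_
  simp only [powSMul_apply, ContinuousLinearMap.smulRight_apply]
  exact (hψ.pow m).smul (hψ.smul continuous_const)

-- Instance synthesis finds the norm of `X →L[𝕜] F**` only with this pending depth.
set_option maxSynthPendingDepth 3 in
theorem exists_bidualEval [CompleteSpace F] (m : ℕ) (ξ : StrongDual 𝕜 (StrongDual 𝕜 E)) :
    ∃ Λ : ContHomPoly 𝕜 (m + 1) E F →L[𝕜] StrongDual 𝕜 (StrongDual 𝕜 F),
      ‖Λ‖ ≤ ‖ξ‖ ^ (m + 1) ∧ (∀ P ∈ weaklyContPoly 𝕜 (m + 1) E F, Λ P ∈ canonicalCopy 𝕜 F) ∧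
        ∀ ψ T φ, Λ (powSMul m ψ T) φ = ξ ψ ^ m * ξ (φ.comp T) := by
  obtain ⟨U, hU, hUξ⟩ := exists_ultrafilter_tendsto_bidual ξ
  have hbound : ∀ᶠ x in (U : Filter E), ‖(inclusionInDoubleDual 𝕜 F).comp
      (evalCLM x : ContHomPoly 𝕜 (m + 1) E F →L[𝕜] F)‖ ≤ ‖ξ‖ ^ (m + 1) := by
    filter_upwards [hU] with x hx
    calc ‖(inclusionInDoubleDual 𝕜 F).comp (evalCLM x : ContHomPoly 𝕜 (m + 1) E F →L[𝕜] F)‖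
        ≤ 1 * ‖x‖ ^ (m + 1) := (ContinuousLinearMap.opNorm_comp_le _ _).trans <|
          mul_le_mul (inclusionInDoubleDual_norm_le 𝕜 F) (norm_evalCLM_le x) (norm_nonneg _)
            zero_le_one
      _ ≤ ‖ξ‖ ^ (m + 1) := by
          rw [one_mul]
          gcongr
          exact mem_closedBall_zero_iff.1 hx
  obtain ⟨Λ, hΛ, hlim⟩ := exists_continuousLinearMap₂_tendsto (by positivity) hbound
  refine ⟨Λ, hΛ, fun P hP => ?_, fun ψ T φ => ?_⟩
  · have hcauchy : Cauchy (map P (U : Filter E)) :=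
      cauchy_map_of_mem_weaklyContPoly hP ⟨_, hU, isBounded_closedBall⟩ fun φ =>
        (hUξ φ).cauchy_map
    obtain ⟨y, hy⟩ := CompleteSpace.complete hcauchy
    exact ⟨y, ContinuousLinearMap.ext fun φ =>
      tendsto_nhds_unique ((φ.continuous.tendsto y).comp hy) (hlim P φ)⟩
  · refine tendsto_nhds_unique (hlim (powSMul m ψ T) φ) ?_
    simpa using ((hUξ ψ).pow m).mul (hUξ (φ.comp T))

end ContHomPoly

section IdealProjections

set_option maxSynthPendingDepth 3

variable {𝕜 X F G : Type*} [RCLike 𝕜] [NormedAddCommGroup X] [NormedSpace 𝕜 X]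
  [NormedAddCommGroup F] [NormedSpace 𝕜 F] [NormedAddCommGroup G] [NormedSpace 𝕜 G]
  {J : Submodule 𝕜 X} {Q : StrongDual 𝕜 X →L[𝕜] StrongDual 𝕜 X} {C : ℝ}

theorem IsIdealProjection.apply_eq_of_mem (hQ : IsIdealProjection J Q) (f : StrongDual 𝕜 X)
    {x : X} (hx : x ∈ J) : Q f x = f x := by
  have hker : Q (f - Q f) = 0 := by rw [map_sub, hQ.idem, sub_self]
  exact (sub_eq_zero.1 ((hQ.ker_eq _).1 hker x hx)).symm

theorem IsIdealProjection.congr (hQ : IsIdealProjection J Q) {f g : StrongDual 𝕜 X}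
    (hfg : ∀ x ∈ J, f x = g x) : Q f = Q g := by
  rw [← sub_eq_zero, ← map_sub, hQ.ker_eq]
  exact fun x hx => sub_eq_zero.2 (hfg x hx)

theorem IsMOneIdeal.norm_add_mul_norm_sub_apply_le (hC : 0 < C) (h : IsMOneIdeal 𝕜 X C J)
    {Λ : X →L[𝕜] G} (hΛ : ‖Λ‖ ≤ 1) {ι : F →L[𝕜] G} (hJ : Set.MapsTo Λ J (Set.range ι))
    (hι : Set.MapsTo ι (closedBall 0 1) (closure (Λ '' (J ∩ closedBall 0 1))))
    {η : G} (hη : η ∈ closure (Λ '' closedBall 0 1)) {f g : StrongDual 𝕜 G}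
    (hfg : f.comp ι = g.comp ι) (hg : ‖g‖ ≤ ‖g.comp ι‖) : ‖g‖ + C * ‖(f - g) η‖ ≤ ‖f‖ := by
  obtain ⟨-, Q, hQ, hQC⟩ := h
  have hcomp (u : StrongDual 𝕜 G) : ‖u.comp Λ‖ ≤ ‖u‖ :=
    (u.opNorm_comp_le Λ).trans (mul_le_of_le_one_right (norm_nonneg u) hΛ)
  have hlower : ‖g‖ ≤ ‖Q (g.comp Λ)‖ := by
    refine hg.trans (ContinuousLinearMap.opNorm_le_of_unit_norm (norm_nonneg _) fun y hy => ?_)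
    refine le_on_closure (f := fun z => ‖g z‖) ?_ g.continuous.norm.continuousOn
      continuousOn_const (hι (mem_closedBall_zero_iff.2 hy.le))
    rintro _ ⟨x, ⟨hxJ, hx⟩, rfl⟩
    rw [← ContinuousLinearMap.comp_apply, ← hQ.apply_eq_of_mem _ hxJ]
    exact (Q (g.comp Λ)).unit_le_opNorm x (mem_closedBall_zero_iff.1 hx)
  have hfix : Q (g.comp Λ) = g.comp Λ := by
    have hzero : C * ‖g.comp Λ - Q (g.comp Λ)‖ ≤ 0 := by
      linarith [hQC (g.comp Λ), hcomp g]
    exact (sub_eq_zero.1 (norm_le_zero_iff.1 (nonpos_of_mul_nonpos_right hzero hC))).symm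
  have hQf : Q (f.comp Λ) = g.comp Λ := by
    refine (hQ.congr fun x hx => ?_).trans hfix
    obtain ⟨y, hy⟩ := hJ hx
    simpa only [ContinuousLinearMap.comp_apply, hy] using DFunLike.congr_fun hfg y
  have hη' : ‖(f - g) η‖ ≤ ‖f.comp Λ - g.comp Λ‖ := by
    refine le_on_closure (f := fun z => ‖(f - g) z‖) ?_ (f - g).continuous.norm.continuousOn
      continuousOn_const hη
    rintro _ ⟨x, hx, rfl⟩
    exact (f.comp Λ - g.comp Λ).unit_le_opNorm x (mem_closedBall_zero_iff.1 hx)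
  calc ‖g‖ + C * ‖(f - g) η‖ ≤ ‖Q (f.comp Λ)‖ + C * ‖f.comp Λ - Q (f.comp Λ)‖ := by
        gcongr
        · rwa [hQf, ← hfix]
        · rwa [hQf]
    _ ≤ ‖f.comp Λ‖ := hQC _
    _ ≤ ‖f‖ := hcomp f

variable (𝕜 F) in
/-- Dixmier's projection of `F***` onto the canonical copy of `F*`: restrict a functional on `F**`
to `F`, then extend it canonically. -/
noncomputable def dixmierProjection :
    StrongDual 𝕜 (StrongDual 𝕜 (StrongDual 𝕜 F)) →L[𝕜]
      StrongDual 𝕜 (StrongDual 𝕜 (StrongDual 𝕜 F)) :=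
  (inclusionInDoubleDual 𝕜 (StrongDual 𝕜 F)).comp
    (ContinuousLinearMap.precomp 𝕜 (inclusionInDoubleDual 𝕜 F))

theorem dixmierProjection_comp_inclusion (f : StrongDual 𝕜 (StrongDual 𝕜 (StrongDual 𝕜 F))) :
    (dixmierProjection 𝕜 F f).comp (inclusionInDoubleDual 𝕜 F) =
      f.comp (inclusionInDoubleDual 𝕜 F) := rfl

theorem norm_dixmierProjection_apply (f : StrongDual 𝕜 (StrongDual 𝕜 (StrongDual 𝕜 F))) :
    ‖dixmierProjection 𝕜 F f‖ = ‖f.comp (inclusionInDoubleDual 𝕜 F)‖ :=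
  (inclusionInDoubleDualLi 𝕜).norm_map (f.comp (inclusionInDoubleDual 𝕜 F))

theorem norm_dixmierProjection_apply_le (f : StrongDual 𝕜 (StrongDual 𝕜 (StrongDual 𝕜 F))) :
    ‖dixmierProjection 𝕜 F f‖ ≤ ‖f‖ := by
  rw [norm_dixmierProjection_apply]
  exact (f.opNorm_comp_le _).trans
    (mul_le_of_le_one_right (norm_nonneg f) (inclusionInDoubleDual_norm_le 𝕜 F))

theorem isIdealProjection_dixmierProjection :
    IsIdealProjection (canonicalCopy 𝕜 F) (dixmierProjection 𝕜 F) where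
  idem _ := rfl
  ker_eq f := by
    rw [← norm_eq_zero, norm_dixmierProjection_apply, norm_eq_zero]
    exact ⟨by rintro hf _ ⟨y, rfl⟩; exact DFunLike.congr_fun hf y,
      fun hf => ContinuousLinearMap.ext fun y => hf _ ⟨y, rfl⟩⟩
  norm_le := ContinuousLinearMap.opNorm_le_bound _ zero_le_one fun f => by
    rw [one_mul]
    exact norm_dixmierProjection_apply_le f

theorem isClosed_canonicalCopy [CompleteSpace F] :
    IsClosed (canonicalCopy 𝕜 F : Set (StrongDual 𝕜 (StrongDual 𝕜 F))) :=
  (inclusionInDoubleDualLi (E := F) 𝕜).isometry.isUniformInducing.isComplete_range.isClosed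

end IdealProjections

section Quotient

variable {𝕜 E F : Type*} [RCLike 𝕜] [NormedAddCommGroup E] [NormedSpace 𝕜 E]
  [NormedAddCommGroup F] [NormedSpace 𝕜 F] {ρ : E →L[𝕜] F}

theorem IsMetricQuotientMap.norm_le_one (hρ : IsMetricQuotientMap ρ) : ‖ρ‖ ≤ 1 := by
  by_contra! hlt
  obtain ⟨x, hx, hρx⟩ := ρ.exists_lt_apply_of_lt_opNorm hlt
  have hmem : ρ x ∈ ball (0 : F) 1 := hρ ▸ ⟨x, mem_ball_zero_iff.2 hx, rfl⟩
  exact hρx.not_gt (mem_ball_zero_iff.1 hmem)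

theorem IsMetricQuotientMap.norm_comp (hρ : IsMetricQuotientMap ρ) (φ : StrongDual 𝕜 F) :
    ‖φ.comp ρ‖ = ‖φ‖ := by
  refine le_antisymm ((φ.opNorm_comp_le ρ).trans
    (mul_le_of_le_one_right (norm_nonneg φ) hρ.norm_le_one)) ?_
  by_contra! hlt
  obtain ⟨y, hy, hφy⟩ := φ.exists_lt_apply_of_lt_opNorm hlt
  obtain ⟨x, hx, rfl⟩ : y ∈ ρ '' ball 0 1 := hρ.symm ▸ mem_ball_zero_iff.2 hy
  exact hφy.not_ge ((φ.comp ρ).unit_le_opNorm x (mem_ball_zero_iff.1 hx).le)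

theorem norm_le_one_of_norm_comp_le (hρ : ∀ φ : StrongDual 𝕜 F, ‖φ.comp ρ‖ ≤ ‖φ‖) :
    ‖ρ‖ ≤ 1 := by
  refine ContinuousLinearMap.opNorm_le_bound _ zero_le_one fun x => ?_
  rw [one_mul]
  refine norm_le_dual_bound 𝕜 (ρ x) (norm_nonneg x) fun φ => ?_
  calc ‖φ (ρ x)‖ ≤ ‖φ.comp ρ‖ * ‖x‖ := (φ.comp ρ).le_opNorm x
    _ ≤ ‖x‖ * ‖φ‖ := by
      rw [mul_comm]
      gcongr
      exact hρ φ

theorem exists_extension_norm_eq_of_linearIsometry (R : F →ₗᵢ[𝕜] E) (η : StrongDual 𝕜 F) :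
    ∃ ξ : StrongDual 𝕜 E, ‖ξ‖ = ‖η‖ ∧ ∀ φ, ξ (R φ) = η φ := by
  obtain ⟨ξ, hξ, hnorm⟩ := exists_extension_norm_eq (LinearMap.range R.toLinearMap)
    (η.comp (R.equivRange.symm : LinearMap.range R.toLinearMap →L[𝕜] F))
  refine ⟨ξ, hnorm.trans (ContinuousLinearMap.opNorm_comp_linearIsometryEquiv η _), fun φ => ?_⟩
  exact (hξ (R.equivRange φ)).trans (congrArg η (R.equivRange.symm_apply_apply φ))

theorem exists_bidual_lift (hρ : ∀ φ : StrongDual 𝕜 F, ‖φ.comp ρ‖ = ‖φ‖)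
    (η : StrongDual 𝕜 (StrongDual 𝕜 F)) :
    ∃ ξ : StrongDual 𝕜 (StrongDual 𝕜 E), ‖ξ‖ = ‖η‖ ∧
      ∀ φ : StrongDual 𝕜 F, ξ (φ.comp ρ) = η φ := by
  let R : StrongDual 𝕜 F →ₗᵢ[𝕜] StrongDual 𝕜 E :=
    { toFun := fun φ => φ.comp ρ
      map_add' := fun _ _ => rfl
      map_smul' := fun _ _ => rfl
      norm_map' := hρ }
  exact exists_extension_norm_eq_of_linearIsometry R η

end Quotient

namespace ContHomPoly

variable {𝕜 E F : Type*} [RCLike 𝕜] [NormedAddCommGroup E] [NormedSpace 𝕜 E]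
  [NormedAddCommGroup F] [NormedSpace 𝕜 F] {m : ℕ} {ξ : StrongDual 𝕜 (StrongDual 𝕜 E)}
  {Λ : ContHomPoly 𝕜 (m + 1) E F →L[𝕜] StrongDual 𝕜 (StrongDual 𝕜 F)}

theorem inclusionInDoubleDual_mem_closure_image
    (hΛ : ∀ ψ T φ, Λ (powSMul m ψ T) φ = ξ ψ ^ m * ξ (φ.comp T)) (hξ : ‖ξ‖ = 1)
    {y : F} (hy : ‖y‖ ≤ 1) :
    inclusionInDoubleDual 𝕜 F y ∈
      closure (Λ '' (weaklyContPoly 𝕜 (m + 1) E F ∩ closedBall 0 1)) := by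
  have hone := norm_mem_closure_image_closedBall ξ
  rw [hξ, RCLike.ofReal_one] at hone
  have hmaps : Set.MapsTo (fun c : 𝕜 => c ^ (m + 1) • inclusionInDoubleDual 𝕜 F y)
      (ξ '' closedBall 0 1) (Λ '' (weaklyContPoly 𝕜 (m + 1) E F ∩ closedBall 0 1)) := by
    rintro _ ⟨ψ, hψ, rfl⟩
    rw [mem_closedBall_zero_iff] at hψ
    refine ⟨powSMul m ψ (ψ.smulRight y), ⟨powSMul_smulRight_mem m ψ y, ?_⟩, ?_⟩
    · refine mem_closedBall_zero_iff.2 ((norm_powSMul_le m ψ _).trans ?_)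
      rw [ContinuousLinearMap.norm_smulRight_apply]
      exact mul_le_one₀ (pow_le_one₀ (norm_nonneg ψ) hψ) (by positivity)
        (mul_le_one₀ hψ (norm_nonneg y) hy)
    · ext φ
      have hcomp : φ.comp (ψ.smulRight y) = φ y • ψ := by
        ext x
        simp [mul_comm]
      simp only [hΛ, hcomp, _root_.map_smul, _root_.smul_apply, dual_def, smul_eq_mul]
      ring
  simpa using map_mem_closure (by fun_prop) hone hmaps

theorem mem_closure_image_closedBall
    (hΛ : ∀ ψ T φ, Λ (powSMul m ψ T) φ = ξ ψ ^ m * ξ (φ.comp T)) (hξ : ‖ξ‖ = 1)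
    {ρ : E →L[𝕜] F} (hρ : ‖ρ‖ ≤ 1) {η : StrongDual 𝕜 (StrongDual 𝕜 F)}
    (hη : ∀ φ : StrongDual 𝕜 F, ξ (φ.comp ρ) = η φ) : η ∈ closure (Λ '' closedBall 0 1) := by
  have hone := norm_mem_closure_image_closedBall ξ
  rw [hξ, RCLike.ofReal_one] at hone
  have hmaps : Set.MapsTo (fun c : 𝕜 => c ^ m • η) (ξ '' closedBall 0 1)
      (Λ '' closedBall 0 1) := by
    rintro _ ⟨ψ, hψ, rfl⟩
    rw [mem_closedBall_zero_iff] at hψ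
    refine ⟨powSMul m ψ ρ, ?_, ?_⟩
    · exact mem_closedBall_zero_iff.2 ((norm_powSMul_le m ψ ρ).trans
        (mul_le_one₀ (pow_le_one₀ (norm_nonneg ψ) hψ) (norm_nonneg ρ) hρ))
    · ext φ
      simp only [hΛ, hη, _root_.smul_apply, smul_eq_mul]
  simpa using map_mem_closure (by fun_prop) hone hmaps

end ContHomPoly

set_option maxSynthPendingDepth 3 in
theorem proposition4p6_general {𝕜 E F : Type*} [RCLike 𝕜]
    [NormedAddCommGroup E] [NormedSpace 𝕜 E]
    [NormedAddCommGroup F] [NormedSpace 𝕜 F] [CompleteSpace F]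
    {ρ : E →L[𝕜] F} (hρ : ∀ φ : StrongDual 𝕜 F, ‖φ.comp ρ‖ = ‖φ‖)
    {n : ℕ} (hn : 1 ≤ n) {C : ℝ} (hC : 0 < C)
    (h : IsMOneIdeal 𝕜 (ContHomPoly 𝕜 n E F) C (weaklyContPoly 𝕜 n E F)) :
    IsMOneIdeal 𝕜 (StrongDual 𝕜 (StrongDual 𝕜 F)) C (canonicalCopy 𝕜 F) := by
  obtain ⟨m, rfl⟩ := Nat.exists_eq_add_of_le' hn
  refine ⟨isClosed_canonicalCopy, dixmierProjection 𝕜 F, isIdealProjection_dixmierProjection,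
    fun f => ?_⟩
  set g := dixmierProjection 𝕜 F f
  have hunit (η : StrongDual 𝕜 (StrongDual 𝕜 F)) (hη : ‖η‖ = 1) :
      ‖g‖ + C * ‖(f - g) η‖ ≤ ‖f‖ := by
    obtain ⟨ξ, hξ, hξρ⟩ := exists_bidual_lift hρ η
    rw [hη] at hξ
    obtain ⟨Λ, hΛ, hmem, hpow⟩ := ContHomPoly.exists_bidualEval (F := F) m ξ
    rw [hξ, one_pow] at hΛ
    exact h.norm_add_mul_norm_sub_apply_le hC hΛ hmem
      (fun y hy => ContHomPoly.inclusionInDoubleDual_mem_closure_image hpow hξ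
        (mem_closedBall_zero_iff.1 hy))
      (ContHomPoly.mem_closure_image_closedBall hpow hξ
        (norm_le_one_of_norm_comp_le fun φ => (hρ φ).le) hξρ)
      (dixmierProjection_comp_inclusion f).symm (norm_dixmierProjection_apply f).le
  have hsub : ‖f - g‖ ≤ (‖f‖ - ‖g‖) / C := by
    refine ContinuousLinearMap.opNorm_le_of_unit_norm
      (div_nonneg (sub_nonneg.2 (norm_dixmierProjection_apply_le f)) hC.le) fun η hη => ?_
    rw [le_div_iff₀' hC]
    linarith [hunit η hη]
  rw [le_div_iff₀' hC] at hsub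
  linarith

theorem proposition4p6 {𝕜 E F : Type*} [RCLike 𝕜]
    [NormedAddCommGroup E] [NormedSpace 𝕜 E] [CompleteSpace E]
    [NormedAddCommGroup F] [NormedSpace 𝕜 F] [CompleteSpace F]
    (hρ : ∃ ρ : E →L[𝕜] F, IsMetricQuotientMap ρ)
    (n : ℕ) (hn : 1 ≤ n) (C : ℝ) (hC : 0 < C)
    (h : IsMOneIdeal 𝕜 (ContHomPoly 𝕜 n E F) C (weaklyContPoly 𝕜 n E F)) :
    IsMOneIdeal 𝕜 (StrongDual 𝕜 (StrongDual 𝕜 F)) C (canonicalCopy 𝕜 F) := by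
  obtain ⟨ρ, hρ⟩ := hρ
  exact proposition4p6_general hρ.norm_comp hn hC h
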